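/- For a Hermitian $n\times n$ matrix $A$ let $\lambda_1(A)\ge\lambda_2(A)\ge\dots\ge\lambda_n(A)$ denote its eigenvalues, counted with multiplicity. Let $M,K_r,K_t$ be nonnegative integers. (1) For every $\mathbf H_1\in\mathbb C^{K_r\times M}$ and every Hermitian positive semidefinite $\mathbf Q_s\in\mathbb C^{M\times M}$ there are a Hermitian positive semidefinite $\mathbf Q_s'\in\mathbb C^{M\times M}$, an orthonormal basis $u_1,\dots,u_M$ of $\mathbb C^M$ and a permutation $\rho$ of $\{1,\dots,\min(K_r,M)\}$ such that $\mathbf H_1^H\mathbf H_1u_i=\lambda_i(\mathbf H_1^H\mathbf H_1)u_i$ for all $i\le M$, every $u_i$ is an eigenvector of $\mathbf Q_s'$, with eigenvalue $\lambda_{\rho(i)}(\mathbf Q_s')$ for $i\le\min(K_r,M)$, and $$\lambda_i(\mathbf H_1\mathbf Q_s\mathbf H_1^H)=\lambda_i(\mathbf H_1\mathbf Q_s'\mathbf H_1^H)\quad(1\le i\le K_r),$$ $$\lambda_i(\mathbf H_1\mathbf Q_s'\mathbf H_1^H)=\lambda_{\rho(i)}(\mathbf Q_s')\,\lambda_i(\mathbf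 H_1^H\mathbf H_1)\quad(1\le i\le\min(K_r,M)),$$ $$\operatorname{Tr}(\mathbf Q_s')\le\operatorname{Tr}(\mathbf Q_s).$$ (2) For every $\bar{\mathbf H}_r\in\mathbb C^{K_r\times K_t}$ and every Hermitian positive semidefinite $\mathbf Q_r\in\mathbb C^{K_t\times K_t}$ there are a matrix $\bar{\mathbf H}_r'\in\mathbb C^{K_r\times K_t}$, an orthonormal basis $u_1,\dots,u_{K_t}$ of $\mathbb C^{K_t}$ and a permutation $\rho$ of $\{1,\dots,\min(K_r,K_t)\}$ such that $\mathbf Q_ru_i=\lambda_i(\mathbf Q_r)u_i$ for all $i\le K_t$, every $u_i$ is an eigenvector of $\bar{\mathbf H}_r'^H\bar{\mathbf H}_r'$, with eigenvalue $\lambda_{\rho(i)}(\bar{\mathbf H}_r'\bar{\mathbf H}_r'^H)$ for $i\le\min(K_r,K_t)$, and $$\lambda_i(\bar{\mathbf H}_r\mathbf Q_r\bar{\mathbf H}_r^H)=\lambda_i(\bar{\mathbf H}_r'\mathbf Q_r\bar{\mathbf H}_r'^H)\quad(1\le i\le K_r),$$ $$\lambda_i(\bar{\mathbf H}_r'\mathbf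 Q_r\bar{\mathbf H}_r'^H)=\lambda_{\rho(i)}(\bar{\mathbf H}_r'\bar{\mathbf H}_r'^H)\,\lambda_i(\mathbf Q_r)\quad(1\le i\le\min(K_r,K_t)),$$ $$\operatorname{Tr}(\bar{\mathbf H}_r'\bar{\mathbf H}_r'^H)\le\operatorname{Tr}(\bar{\mathbf H}_r\bar{\mathbf H}_r^H).$$ -/

import Mathlib

open Matrix
open scoped ComplexOrder

/-- The eigenvalues `λ₁(A) ≥ λ₂(A) ≥ … ≥ λₙ(A)` of a Hermitian matrix, listed with multiplicity in
decreasing order (the index is zero-based: `sortedEigenvalues hA 0` is the largest one). -/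
noncomputable def sortedEigenvalues {n : ℕ} {A : Matrix (Fin n) (Fin n) ℂ} (hA : A.IsHermitian)
    (i : Fin n) : ℝ :=
  hA.eigenvalues₀ (Fin.cast (Fintype.card_fin n).symm i)

/-! Both halves rest on one inequality. If `μ` and `g` are the decreasing eigenvalues of `X A Xᴴ`
and `A ≥ 0`, then `∑ μ i / g i ≤ Tr (X Xᴴ)` (`pos_and_sum_sortedEigenvalues_div_le`). The quotients
`q i = μ i / g i` are exactly the spectrum a matrix aligned with the eigenbasis of `A` needs in
order to reproduce `μ`, so alignment never costs trace.

For the inequality, diagonalize `A` and `X A Xᴴ` and put `Z = μ^(-1/2) X g^(1/2)`. Then `Z Zᴴ` is a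
diagonal projection, so `P i k = |Z i k|²` has row sums one (zero where `μ i = 0`) and column sums
at most one, while `Tr (X Xᴴ) ≥ ∑ μ i * P i k / g k`. As `μ` decreases and `1 / g` increases, this
linear functional of `P` is smallest when equal indices are paired; a dual certificate proves it.

In (1), `Qs = Y Yᴴ` and the inequality is applied to `X = Yᴴ`, `A = H₁ᴴ H₁`; in (2), to `X = Hr`, `A
= Qr`. The quotients need not be decreasing, hence the permutation `ρ`. Padding by zeros compares
spectra of matrices of different sizes. -/

/-! ### Zero-padded sequences. -/

/-- Extension of a finite sequence by zeros. -/
def zeroPad {n : ℕ} (f : Fin n → ℝ) (i : ℕ) : ℝ := if h : i < n then f ⟨i, h⟩ else 0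

lemma zeroPad_of_lt {n : ℕ} (f : Fin n → ℝ) {i : ℕ} (h : i < n) : zeroPad f i = f ⟨i, h⟩ :=
  dif_pos h

lemma zeroPad_of_le {n : ℕ} (f : Fin n → ℝ) {i : ℕ} (h : n ≤ i) : zeroPad f i = 0 :=
  dif_neg (not_lt.mpr h)

@[simp] lemma zeroPad_coe {n : ℕ} (f : Fin n → ℝ) (i : Fin n) : zeroPad f i = f i :=
  zeroPad_of_lt f i.isLt

lemma zeroPad_nonneg {n : ℕ} {f : Fin n → ℝ} (hf : ∀ i, 0 ≤ f i) (i : ℕ) : 0 ≤ zeroPad f i := by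
  unfold zeroPad
  split
  · exact hf _
  · exact le_rfl

lemma zeroPad_antitone {n : ℕ} {f : Fin n → ℝ} (hf : ∀ i, 0 ≤ f i) (h : Antitone f) :
    Antitone (zeroPad f) := by
  intro i j hij
  by_cases hj : j < n
  · rw [zeroPad_of_lt f hj, zeroPad_of_lt f (hij.trans_lt hj)]
    exact h hij
  · rw [zeroPad_of_le f (not_lt.mp hj)]
    exact zeroPad_nonneg hf i

lemma map_zeroPad_range {n : ℕ} (f : Fin n → ℝ) (k : ℕ) :
    ((List.range (n + k)).map (zeroPad f) : Multiset ℝ) =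
      Finset.univ.val.map f + k • ({0} : Multiset ℝ) := by
  have h1 : (List.range n).map (zeroPad f) = List.ofFn f := by
    apply List.ext_getElem
    · simp
    · intro i h1 h2
      simp only [List.length_map, List.length_range] at h1
      simp [zeroPad_of_lt f h1]
  have h2 : (List.range k).map (zeroPad f ∘ (n + ·)) = List.replicate k 0 := by
    apply List.ext_getElem
    · simp
    · intro i h1 h2
      simp [zeroPad_of_le f (Nat.le_add_right n i)]
  rw [List.range_add, List.map_append, List.map_map, h1, h2, ← Multiset.coe_add,
    Fin.univ_val_map, Multiset.nsmul_singleton, Multiset.coe_replicate]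

/-- A decreasing list is determined by its multiset; the added zeros bring both lists to length `m +
n`. -/
lemma zeroPad_eq_zeroPad {m n : ℕ} {f : Fin m → ℝ} {g : Fin n → ℝ}
    (hf : ∀ i, 0 ≤ f i) (hg : ∀ i, 0 ≤ g i) (hfa : Antitone f) (hga : Antitone g)
    (h : Finset.univ.val.map f + n • ({0} : Multiset ℝ) =
      Finset.univ.val.map g + m • ({0} : Multiset ℝ)) : zeroPad f = zeroPad g := by
  rw [← map_zeroPad_range, ← map_zeroPad_range, add_comm n m, Multiset.coe_eq_coe] at h
  have key : (List.range (m + n)).map (zeroPad f) = (List.range (m + n)).map (zeroPad g) :=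
    h.eq_of_pairwise' (r := (· ≥ ·))
      (List.pairwise_map.mpr ((List.pairwise_lt_range).imp
        fun hab => zeroPad_antitone hf hfa hab.le))
      (List.pairwise_map.mpr ((List.pairwise_lt_range).imp
        fun hab => zeroPad_antitone hg hga hab.le))
  ext i
  by_cases hi : i < m + n
  · exact List.map_inj_left.mp key i (List.mem_range.mpr hi)
  · rw [zeroPad_of_le f (by omega), zeroPad_of_le g (by omega)]

/-! ### Sorted eigenvalues and diagonalizations. -/

lemma sortedEigenvalues_antitone {n : ℕ} {A : Matrix (Fin n) (Fin n) ℂ} (hA : A.IsHermitian) :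
    Antitone (sortedEigenvalues hA) :=
  fun _ _ hij => hA.eigenvalues₀_antitone hij

lemma map_sortedEigenvalues {n : ℕ} {A : Matrix (Fin n) (Fin n) ℂ} (hA : A.IsHermitian) :
    Finset.univ.val.map (sortedEigenvalues hA) = A.charpoly.roots.map Complex.re := by
  have h1 : (sortedEigenvalues hA) =
      hA.eigenvalues ∘ ((finCongr (Fintype.card_fin n).symm).trans
        (Fintype.equivOfCardEq (Fintype.card_fin _))) := by
    ext i
    simp [sortedEigenvalues, IsHermitian.eigenvalues]
  rw [h1, hA.roots_charpoly_eq_eigenvalues, Multiset.map_map, ← Multiset.map_map hA.eigenvalues,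
    Multiset.map_univ_val_equiv]
  rfl

lemma exists_unitary_sortedEigenvalues {n : ℕ} {A : Matrix (Fin n) (Fin n) ℂ}
    (hA : A.IsHermitian) : ∃ U ∈ unitaryGroup (Fin n) ℂ,
      A = U * diagonal (fun i => (sortedEigenvalues hA i : ℂ)) * Uᴴ := by
  set e : Fin n ≃ Fin n := (finCongr (Fintype.card_fin n).symm).trans
        (Fintype.equivOfCardEq (Fintype.card_fin _)) with he
  have h1 : (fun i => (sortedEigenvalues hA i : ℂ)) = (RCLike.ofReal ∘ hA.eigenvalues) ∘ e := by
    ext i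
    simp [he, sortedEigenvalues, IsHermitian.eigenvalues]
  have hV := hA.eigenvectorUnitary.2
  rw [mem_unitaryGroup_iff', star_eq_conjTranspose] at hV
  refine ⟨(hA.eigenvectorUnitary : Matrix (Fin n) (Fin n) ℂ).submatrix id e, ?_, ?_⟩
  · rw [mem_unitaryGroup_iff', star_eq_conjTranspose, conjTranspose_submatrix,
      ← submatrix_mul _ _ _ id _ Function.bijective_id, hV, submatrix_one_equiv]
  · rw [h1, ← submatrix_diagonal_equiv, conjTranspose_submatrix,
      submatrix_mul_equiv, submatrix_mul_equiv, submatrix_id_id]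
    conv_lhs => rw [hA.spectral_theorem, Unitary.conjStarAlgAut_apply]
    rfl

lemma sortedEigenvalues_eq_of_diagonalization {n : ℕ} {A U : Matrix (Fin n) (Fin n) ℂ}
    (hA : A.IsHermitian) (hU : U ∈ unitaryGroup (Fin n) ℂ) {d : Fin n → ℝ}
    (h : A = U * diagonal (fun i => (d i : ℂ)) * Uᴴ) (σ : Equiv.Perm (Fin n))
    (hd : Antitone (d ∘ σ)) : sortedEigenvalues hA = d ∘ σ := by
  have hroots : A.charpoly.roots.map Complex.re = Finset.univ.val.map (d ∘ σ) := by
    rw [mem_unitaryGroup_iff', star_eq_conjTranspose] at hU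
    rw [h, charpoly_mul_comm, ← mul_assoc, hU, one_mul, charpoly_diagonal,
      Polynomial.roots_prod _ _
        (by simp [Finset.prod_ne_zero_iff, Polynomial.X_sub_C_ne_zero])]
    rw [← Multiset.map_map d σ, Multiset.map_univ_val_equiv]
    simp [Function.comp_def]
  rw [← map_sortedEigenvalues hA, Fin.univ_val_map, Fin.univ_val_map, Multiset.coe_eq_coe] at hroots
  apply List.ofFn_injective
  exact hroots.eq_of_pairwise' (r := (· ≥ ·))
    (List.pairwise_ofFn.mpr fun i j hij => sortedEigenvalues_antitone hA hij.le)
    (List.pairwise_ofFn.mpr fun i j hij => hd hij.le)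

lemma sortedEigenvalues_congr {n : ℕ} {A B : Matrix (Fin n) (Fin n) ℂ} (hA : A.IsHermitian)
    (hB : B.IsHermitian) (h : A = B) : sortedEigenvalues hA = sortedEigenvalues hB := by
  subst h; rfl

lemma sortedEigenvalues_nonneg {n : ℕ} {A : Matrix (Fin n) (Fin n) ℂ} (hA : A.PosSemidef)
    (i : Fin n) : 0 ≤ sortedEigenvalues hA.isHermitian i := by
  have := hA.eigenvalues_nonneg (Fintype.equivOfCardEq (Fintype.card_fin _)
    (Fin.cast (Fintype.card_fin n).symm i))
  simpa [sortedEigenvalues, IsHermitian.eigenvalues] using this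

/-- The characteristic polynomials of `Z Zᴴ` and `Zᴴ Z` agree up to powers of the variable, so the
spectra differ only by zeros. -/
lemma zeroPad_sortedEigenvalues_mul_comm {m n : ℕ} (Z : Matrix (Fin m) (Fin n) ℂ) :
    zeroPad (sortedEigenvalues (isHermitian_mul_conjTranspose_self Z)) =
      zeroPad (sortedEigenvalues (isHermitian_conjTranspose_mul_self Z)) := by
  apply zeroPad_eq_zeroPad (sortedEigenvalues_nonneg (posSemidef_self_mul_conjTranspose Z))
    (sortedEigenvalues_nonneg (posSemidef_conjTranspose_mul_self Z))
    (sortedEigenvalues_antitone _) (sortedEigenvalues_antitone _)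
  rw [map_sortedEigenvalues, map_sortedEigenvalues]
  have h := congrArg (fun p => p.roots.map Complex.re) (charpoly_mul_comm' Z Zᴴ)
  simp only [Fintype.card_fin] at h
  rw [Polynomial.roots_mul (mul_ne_zero (pow_ne_zero _ Polynomial.X_ne_zero)
      (charpoly_monic _).ne_zero),
    Polynomial.roots_mul (mul_ne_zero (pow_ne_zero _ Polynomial.X_ne_zero)
      (charpoly_monic _).ne_zero)] at h
  simpa [add_comm, Multiset.map_nsmul] using h

/-- If a diagonalization of `A` has nonnegative entries that vanish from position `k` on, then its
first `k` entries are a permutation of the `k` largest eigenvalues of `A`. -/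
lemma exists_perm_sortedEigenvalues {n k : ℕ} (hk : k ≤ n) {A U : Matrix (Fin n) (Fin n) ℂ}
    (hA : A.IsHermitian) (hU : U ∈ unitaryGroup (Fin n) ℂ) {d : Fin n → ℝ}
    (h : A = U * diagonal (fun i => (d i : ℂ)) * Uᴴ) (hd : ∀ i, 0 ≤ d i)
    (hdk : ∀ i : Fin n, k ≤ (i : ℕ) → d i = 0) :
    ∃ ρ : Equiv.Perm (Fin k), ∀ i : Fin k,
      d (Fin.castLE hk i) = sortedEigenvalues hA (Fin.castLE hk (ρ i)) := by
  set f : Fin k → ℝ := d ∘ Fin.castLE hk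
  set σ := Tuple.sort (fun i => -f i)
  have hσ : Antitone (f ∘ σ) := fun i j hij => by
    have := Tuple.monotone_sort (fun i => -f i) hij
    simpa using this
  -- Only the first `k` entries are sorted; the zeros after them are already in place, so the
  -- permutation stays within `Fin k`.
  set τ : Equiv.Perm (Fin n) := σ.viaEmbedding (Fin.castLEEmb hk)
  have hτ : ∀ i : Fin k, τ (Fin.castLE hk i) = Fin.castLE hk (σ i) :=
    fun i => σ.viaEmbedding_apply (Fin.castLEEmb hk) i
  have hlt : ∀ i : Fin n, (hi : (i : ℕ) < k) → i = Fin.castLE hk ⟨i, hi⟩ := fun i hi => rfl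
  have hτ' : ∀ i : Fin n, k ≤ (i : ℕ) → τ i = i := fun i hi =>
    σ.viaEmbedding_apply_of_notMem (Fin.castLEEmb hk) i (by
      rintro ⟨j, rfl⟩
      exact absurd hi (not_le.mpr j.isLt))
  have hdτ : Antitone (d ∘ τ) := by
    intro i j hij
    by_cases hj : (j : ℕ) < k
    · have hi : (i : ℕ) < k := lt_of_le_of_lt hij hj
      rw [hlt i hi, hlt j hj, Function.comp_apply, Function.comp_apply, hτ, hτ]
      exact hσ (a := ⟨i, hi⟩) (b := ⟨j, hj⟩) hij
    · rw [Function.comp_apply, hτ' j (not_lt.mp hj), hdk j (not_lt.mp hj)]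
      exact hd _
  refine ⟨σ.symm, fun i => ?_⟩
  rw [sortedEigenvalues_eq_of_diagonalization hA hU h τ hdτ, Function.comp_apply, hτ,
    Equiv.apply_symm_apply]

/-! ### The linear program over substochastic matrices. -/

/-- Dual certificate for the linear program minimizing `∑ μ i * h k * P i k` over doubly
substochastic `P` whose rows with `μ i ≠ 0` sum to one. -/
lemma exists_dual_certificate {μ h : ℕ → ℝ} (hμ : Antitone μ) (hμ0 : ∀ k, 0 ≤ μ k)
    (hh : Monotone h) {m : ℕ} (hm : ∀ k, m ≤ k → μ k = 0) :
    ∃ b : ℕ → ℝ, (∀ k, 0 ≤ b k) ∧ (∀ k, μ k = 0 → b k = 0) ∧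
      ∀ i k, μ i * h i + b i - b k ≤ μ i * h k := by
  -- Abel-type sum making the constraint tight for adjacent indices `i = k + 1`; the others follow
  -- by telescoping, with `μ` decreasing.
  set b : ℕ → ℝ := fun k => ∑ j ∈ Finset.Ico k m, μ (j + 1) * (h (j + 1) - h j) with hb
  have hstep : ∀ k, b k = b (k + 1) + μ (k + 1) * (h (k + 1) - h k) := by
    intro k
    simp only [hb]
    by_cases hk : k < m
    · rw [Finset.sum_eq_sum_Ico_succ_bot hk, add_comm]
    · rw [Finset.Ico_eq_empty (by omega), Finset.Ico_eq_empty (by omega), hm (k + 1) (by omega)]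
      simp
  refine ⟨b, fun k => Finset.sum_nonneg fun j _ => mul_nonneg (hμ0 _)
    (sub_nonneg.mpr (hh j.le_succ)), fun k hk => Finset.sum_eq_zero fun j hj => ?_, ?_⟩
  · have h1 : μ (j + 1) ≤ μ k := hμ ((Finset.mem_Ico.mp hj).1.trans j.le_succ)
    rw [le_antisymm (h1.trans hk.le) (hμ0 _), zero_mul]
  · have up : ∀ i d, μ i * h i + b i - b (i + d) ≤ μ i * h (i + d) := by
      intro i d
      induction d with
      | zero => simp
      | succ d ih =>
        have h1 := hstep (i + d)
        have h2 : μ (i + d + 1) * (h (i + d + 1) - h (i + d)) ≤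
            μ i * (h (i + d + 1) - h (i + d)) :=
          mul_le_mul_of_nonneg_right (hμ (by omega)) (sub_nonneg.mpr (hh (Nat.le_succ _)))
        rw [← add_assoc]
        linarith
    have down : ∀ k d, μ (k + d) * h (k + d) + b (k + d) - b k ≤ μ (k + d) * h k := by
      intro k d
      induction d with
      | zero => simp
      | succ d ih =>
        have h1 := hstep (k + d)
        have h2 : μ (k + d + 1) * (h (k + d) - h k) ≤ μ (k + d) * (h (k + d) - h k) :=
          mul_le_mul_of_nonneg_right (hμ (Nat.le_succ _)) (sub_nonneg.mpr (hh (by omega)))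
        rw [← add_assoc]
        linarith
    intro i k
    rcases le_total i k with hik | hik
    · obtain ⟨d, rfl⟩ := Nat.exists_eq_add_of_le hik
      exact up i d
    · obtain ⟨d, rfl⟩ := Nat.exists_eq_add_of_le hik
      exact down k d

/-- Weak duality: weight the certificate inequalities by `P` and sum. Rows of mass zero do no harm
because `b` vanishes where `μ` does. -/
lemma sum_mul_le_of_substochastic {m n : ℕ} {μ h : ℕ → ℝ} (hμ : Antitone μ)
    (hμ0 : ∀ k, 0 ≤ μ k) (hh : Monotone h) (hm : ∀ k, m ≤ k → μ k = 0) {P : Fin m → Fin n → ℝ}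
    (hP : ∀ i k, 0 ≤ P i k) (hrow : ∀ i : Fin m, ∑ k, P i k = if μ i = 0 then 0 else 1)
    (hcol : ∀ k, ∑ i, P i k ≤ 1) :
    ∑ i ∈ Finset.range m, μ i * h i ≤ ∑ i : Fin m, ∑ k : Fin n, μ i * P i k * h k := by
  obtain ⟨b, hb0, hbz, hb⟩ := exists_dual_certificate hμ hμ0 hh hm
  have h1 : ∑ i : Fin m, ∑ k : Fin n, P i k * (μ i * h i + b i - b k) ≤
      ∑ i : Fin m, ∑ k : Fin n, μ i * P i k * h k := by
    refine Finset.sum_le_sum fun i _ => Finset.sum_le_sum fun k _ => ?_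
    calc P i k * (μ i * h i + b i - b k) ≤ P i k * (μ i * h k) :=
          mul_le_mul_of_nonneg_left (hb i k) (hP i k)
      _ = _ := by ring
  refine le_trans ?_ h1
  have h2 : ∑ i : Fin m, ∑ k : Fin n, P i k * (μ i * h i + b i - b k) =
      ∑ i : Fin m, (μ i * h i + b i) - ∑ k : Fin n, (∑ i, P i k) * b k := by
    simp only [mul_sub, Finset.sum_sub_distrib]
    congr 1
    · refine Finset.sum_congr rfl fun i _ => ?_
      rw [← Finset.sum_mul, hrow]
      split_ifs with hi
      · simp [hi, hbz _ hi]
      · simp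
    · rw [Finset.sum_comm]
      exact Finset.sum_congr rfl fun k _ => (Finset.sum_mul ..).symm
  have h3 : ∑ k : Fin n, (∑ i, P i k) * b k ≤ ∑ i : Fin m, b i := by
    calc ∑ k : Fin n, (∑ i, P i k) * b k ≤ ∑ k : Fin n, b k :=
          Finset.sum_le_sum fun k _ => mul_le_of_le_one_left (hb0 k) (hcol k)
      _ = ∑ k ∈ Finset.range n, b k := Fin.sum_univ_eq_sum_range b n
      -- Neither of `m`, `n` need be the larger; `b` is nonnegative and vanishes from `m` on.
      _ ≤ ∑ k ∈ Finset.range (max m n), b k :=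
          Finset.sum_le_sum_of_subset_of_nonneg
            (Finset.range_subset_range.mpr (le_max_right _ _)) fun k _ _ => hb0 k
      _ = ∑ k ∈ Finset.range m, b k :=
          (Finset.sum_subset (Finset.range_subset_range.mpr (le_max_left _ _))
            fun k _ hk => hbz k (hm k (by simpa using hk))).symm
      _ = ∑ i : Fin m, b i := (Fin.sum_univ_eq_sum_range b m).symm
  rw [h2, Finset.sum_add_distrib, Fin.sum_univ_eq_sum_range (fun i => μ i * h i) m]
  linarith

/-! ### The trace inequality. -/

/-- `Z` is a partial isometry, so `1 - Zᴴ Z` is a projection and its diagonal is nonnegative. -/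
lemma sum_normSq_col_le_one {m n : ℕ} {Z : Matrix (Fin m) (Fin n) ℂ} (h : Z * Zᴴ * Z = Z)
    (k : Fin n) : ∑ i, Complex.normSq (Z i k) ≤ 1 := by
  have h1 : (1 - Zᴴ * Z)ᴴ * (1 - Zᴴ * Z) = 1 - Zᴴ * Z := by
    have : Zᴴ * Z * (Zᴴ * Z) = Zᴴ * Z := by rw [Matrix.mul_assoc, ← Matrix.mul_assoc Z, h]
    simp [sub_mul, mul_sub, this]
  have h2 := (posSemidef_conjTranspose_mul_self (1 - Zᴴ * Z)).diag_nonneg (i := k)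
  rw [h1, Matrix.sub_apply, one_apply_eq, mul_apply] at h2
  simp only [conjTranspose_apply, Complex.star_def, ← Complex.normSq_eq_conj_mul_self] at h2
  have h3 : (0 : ℝ) ≤ 1 - ∑ i, Complex.normSq (Z i k) := by exact_mod_cast h2
  linarith

lemma trace_mul_conjTranspose_re {m n : ℕ} (X : Matrix (Fin m) (Fin n) ℂ) :
    (X * Xᴴ).trace.re = ∑ i, ∑ k, Complex.normSq (X i k) := by
  simp [trace, mul_apply, Complex.mul_conj]

/-- Mass count: if `μ i > 0`, rows `0, …, i` carry mass `i + 1`; if `g i = 0`, only the `i` columns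
before `i` can carry mass, at most one each. -/
lemma pos_of_substochastic {m n : ℕ} {μ : Fin m → ℝ} {g : Fin n → ℝ} (hμ : Antitone μ)
    (hg : Antitone g) (hg0 : ∀ k, 0 ≤ g k) {P : Fin m → Fin n → ℝ}
    (hrow : ∀ i : Fin m, ∑ k, P i k = if μ i = 0 then 0 else 1)
    (hcol : ∀ k, ∑ i, P i k ≤ 1) (hPg : ∀ i k, g k = 0 → P i k = 0) {i : ℕ}
    (hi : 0 < zeroPad μ i) : 0 < zeroPad g i := by
  by_contra hgi
  have hgi : zeroPad g i = 0 := le_antisymm (not_lt.mp hgi) (zeroPad_nonneg hg0 i)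
  have him : i < m := by
    by_contra hh
    rw [zeroPad_of_le μ (not_lt.mp hh)] at hi
    exact lt_irrefl _ hi
  have h1 : ((i : ℝ) + 1) ≤ ∑ j, ∑ k, P j k := by
    calc ((i : ℝ) + 1) = ∑ j ∈ Finset.Iic (⟨i, him⟩ : Fin m), (1 : ℝ) := by simp
      _ = ∑ j ∈ Finset.Iic (⟨i, him⟩ : Fin m), ∑ k, P j k := by
          refine Finset.sum_congr rfl fun j hj => ?_
          rw [zeroPad_of_lt μ him] at hi
          rw [hrow, if_neg (hi.trans_le (hμ (Finset.mem_Iic.mp hj))).ne']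
      _ ≤ ∑ j, ∑ k, P j k := by
          refine Finset.sum_le_sum_of_subset_of_nonneg (Finset.subset_univ _) fun j _ _ => ?_
          rw [hrow]
          split_ifs <;> norm_num
  have h2 : ∑ j, ∑ k, P j k ≤ i := by
    rw [Finset.sum_comm]
    calc ∑ k, ∑ j, P j k ≤ ∑ k : Fin n, (if (k : ℕ) < i then 1 else 0 : ℝ) := by
          refine Finset.sum_le_sum fun k _ => ?_
          split_ifs with hk
          · exact hcol k
          · have h0 : g k = 0 := le_antisymm (by
              rw [← zeroPad_coe g k, ← hgi]
              exact zeroPad_antitone hg0 hg (not_lt.mp hk)) (hg0 k)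
            exact (Finset.sum_eq_zero fun j _ => hPg j k h0).le
      _ = ∑ k ∈ Finset.range n, (if k < i then 1 else 0 : ℝ) :=
          Fin.sum_univ_eq_sum_range (fun k => (if k < i then 1 else 0 : ℝ)) n
      _ = ((Finset.range n).filter (· < i)).card := by simp
      _ ≤ i := by
          have : (Finset.range n).filter (· < i) ⊆ Finset.range i := fun x hx =>
            Finset.mem_range.mpr (Finset.mem_filter.mp hx).2
          exact_mod_cast (Finset.card_le_card this).trans (Finset.card_range i).le
  linarith

lemma pos_and_sum_div_le_of_diagonal {m n : ℕ} {μ : Fin m → ℝ} {g : Fin n → ℝ} (hμ : Antitone μ)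
    (hμ0 : ∀ i, 0 ≤ μ i) (hg : Antitone g) (hg0 : ∀ k, 0 ≤ g k) {X : Matrix (Fin m) (Fin n) ℂ}
    (hX : X * diagonal (fun k => (g k : ℂ)) * Xᴴ = diagonal (fun i => (μ i : ℂ))) :
    (∀ i, 0 < zeroPad μ i → 0 < zeroPad g i) ∧
      ∑ i ∈ Finset.range m, zeroPad μ i / zeroPad g i ≤ (X * Xᴴ).trace.re := by
  -- Since `0⁻¹ = 0`, rows with `μ i = 0` become zero.
  set Z : Matrix (Fin m) (Fin n) ℂ := diagonal (fun i => (((√(μ i))⁻¹ : ℝ) : ℂ)) * X *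
    diagonal (fun k => ((√(g k) : ℝ) : ℂ)) with hZ
  have hZik : ∀ i k, Complex.normSq (Z i k) = Complex.normSq (X i k) * g k / μ i := by
    intro i k
    rw [hZ, mul_diagonal, diagonal_mul, Complex.normSq_mul, Complex.normSq_mul,
      Complex.normSq_ofReal, Complex.normSq_ofReal, Real.mul_self_sqrt (hg0 k), ← mul_inv,
      Real.mul_self_sqrt (hμ0 i)]
    ring
  have hZZ : Z * Zᴴ = diagonal (fun i => if μ i = 0 then 0 else 1) := by
    have h1 : Z * Zᴴ = diagonal (fun i => (((√(μ i))⁻¹ : ℝ) : ℂ)) *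
        (X * diagonal (fun k => (g k : ℂ)) * Xᴴ) *
        diagonal (fun i => (((√(μ i))⁻¹ : ℝ) : ℂ)) := by
      have h2 : diagonal (fun k => (g k : ℂ)) = diagonal (fun k => ((√(g k) : ℝ) : ℂ)) *
          diagonal (fun k => ((√(g k) : ℝ) : ℂ)) := by
        rw [diagonal_mul_diagonal]
        congr 1
        ext k
        rw [← Complex.ofReal_mul, Real.mul_self_sqrt (hg0 k)]
      have h3 : ∀ (l : ℕ) (d : Fin l → ℝ), (diagonal (fun k => (d k : ℂ)))ᴴ =
          diagonal (fun k => (d k : ℂ)) := by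
        intro l d
        rw [diagonal_conjTranspose]
        congr 1
        ext k
        simp
      rw [h2, hZ, conjTranspose_mul, conjTranspose_mul, h3 _ (fun k => √(g k)),
        h3 _ (fun k => (√(μ k))⁻¹)]
      simp only [Matrix.mul_assoc]
    rw [h1, hX, diagonal_mul_diagonal, diagonal_mul_diagonal]
    congr 1
    ext i
    split_ifs with hi
    · simp [hi]
    · have hpos : 0 < √(μ i) := Real.sqrt_pos.mpr (lt_of_le_of_ne (hμ0 i) (Ne.symm hi))
      have : (√(μ i))⁻¹ * μ i * (√(μ i))⁻¹ = 1 := by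
        nth_rewrite 2 [← Real.mul_self_sqrt (hμ0 i)]
        field_simp
      exact_mod_cast this
  have hrow : ∀ i : Fin m, ∑ k, Complex.normSq (Z i k) = if μ i = 0 then 0 else 1 := by
    intro i
    have h1 := congrFun (congrFun hZZ i) i
    rw [diagonal_apply_eq, mul_apply] at h1
    simp only [conjTranspose_apply, Complex.star_def, Complex.mul_conj] at h1
    split_ifs at h1 ⊢ <;> exact_mod_cast h1
  have hcol : ∀ k : Fin n, ∑ i, Complex.normSq (Z i k) ≤ 1 := by
    refine sum_normSq_col_le_one ?_
    ext i k
    rw [hZZ, diagonal_mul]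
    split_ifs with hi
    · have : Complex.normSq (Z i k) = 0 := by rw [hZik, hi, div_zero]
      rw [Complex.normSq_eq_zero.mp this, mul_zero]
    · rw [one_mul]
  have hpos : ∀ i, 0 < zeroPad μ i → 0 < zeroPad g i := fun i hi =>
    pos_of_substochastic hμ hg hg0 hrow hcol (fun i k hk => by rw [hZik, hk]; simp) hi
  refine ⟨hpos, ?_⟩
  have hg0' := zeroPad_nonneg hg0
  have hμ0' := zeroPad_nonneg hμ0
  have hganti := zeroPad_antitone hg0 hg
  -- Where `g` vanishes, `1 / g` is replaced by a constant above all its other values, which keeps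
  -- `h` increasing; `P` has no mass in those columns.
  set C : ℝ := ∑ k ∈ Finset.range n, (zeroPad g k)⁻¹ with hC
  set h : ℕ → ℝ := fun k => if zeroPad g k = 0 then C else (zeroPad g k)⁻¹ with hh
  have hmono : Monotone h := by
    intro j k hjk
    simp only [hh]
    split_ifs with h1 h2 h2
    · exact le_rfl
    · exact absurd (le_antisymm ((hganti hjk).trans h1.le) (hg0' k)) h2
    · refine Finset.single_le_sum (f := fun k => (zeroPad g k)⁻¹)
        (fun k _ => inv_nonneg.mpr (hg0' k)) (Finset.mem_range.mpr ?_)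
      by_contra hj
      exact h1 (zeroPad_of_le g (not_lt.mp hj))
    · exact inv_anti₀ (lt_of_le_of_ne (hg0' k) (Ne.symm h2)) (hganti hjk)
  have key := sum_mul_le_of_substochastic (P := fun i k => Complex.normSq (Z i k))
    (zeroPad_antitone hμ0 hμ) hμ0' hmono (m := m) (fun k hk => zeroPad_of_le μ hk)
    (fun i k => Complex.normSq_nonneg _) (by simpa using hrow) hcol
  calc ∑ i ∈ Finset.range m, zeroPad μ i / zeroPad g i
      = ∑ i ∈ Finset.range m, zeroPad μ i * h i := by
        refine Finset.sum_congr rfl fun i _ => ?_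
        rcases (hμ0' i).eq_or_lt with h0 | h0
        · rw [← h0, zero_div, zero_mul]
        · simp only [hh, if_neg (hpos i h0).ne', div_eq_mul_inv]
    _ ≤ _ := key
    _ ≤ ∑ i, ∑ k, Complex.normSq (X i k) := by
        refine Finset.sum_le_sum fun i _ => Finset.sum_le_sum fun k _ => ?_
        rw [zeroPad_coe, hZik]
        simp only [hh, zeroPad_coe]
        rcases (hμ0 i).eq_or_lt with h0 | h0
        · rw [← h0]; simpa using Complex.normSq_nonneg _
        · rcases (hg0 k).eq_or_lt with h1 | h1
          · rw [← h1]; simpa using Complex.normSq_nonneg _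
          · rw [if_neg h1.ne']
            exact le_of_eq (by field_simp)
    _ = _ := (trace_mul_conjTranspose_re X).symm

/-- The sum of the quotients of the ordered eigenvalues of `X A Xᴴ` and `A` is at most
`Tr (X Xᴴ)`. -/
lemma pos_and_sum_sortedEigenvalues_div_le {m n : ℕ} (X : Matrix (Fin m) (Fin n) ℂ)
    {A : Matrix (Fin n) (Fin n) ℂ} (hA : A.PosSemidef) (hB : (X * A * Xᴴ).IsHermitian) :
    (∀ i, 0 < zeroPad (sortedEigenvalues hB) i →
        0 < zeroPad (sortedEigenvalues hA.isHermitian) i) ∧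
      ∑ i ∈ Finset.range m, zeroPad (sortedEigenvalues hB) i /
        zeroPad (sortedEigenvalues hA.isHermitian) i ≤ (X * Xᴴ).trace.re := by
  obtain ⟨V, hV, hVA⟩ := exists_unitary_sortedEigenvalues hA.isHermitian
  obtain ⟨W, hW, hWB⟩ := exists_unitary_sortedEigenvalues hB
  rw [mem_unitaryGroup_iff', star_eq_conjTranspose] at hW
  have hV' := hV
  rw [mem_unitaryGroup_iff', star_eq_conjTranspose] at hV
  rw [mem_unitaryGroup_iff, star_eq_conjTranspose] at hV'
  have hW' : W * Wᴴ = 1 := mul_eq_one_comm.mp hW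
  have key := pos_and_sum_div_le_of_diagonal (X := Wᴴ * X * V) (sortedEigenvalues_antitone hB)
    (sortedEigenvalues_nonneg (hA.mul_mul_conjTranspose_same X))
    (sortedEigenvalues_antitone hA.isHermitian) (sortedEigenvalues_nonneg hA) (by
      calc _ = Wᴴ * (X * (V * diagonal (fun i =>
            (sortedEigenvalues hA.isHermitian i : ℂ)) * Vᴴ) * Xᴴ) * W := by
            simp only [conjTranspose_mul, conjTranspose_conjTranspose, Matrix.mul_assoc]
        _ = Wᴴ * (W * diagonal (fun i => (sortedEigenvalues hB i : ℂ)) * Wᴴ) * W := by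
            rw [← hVA, ← hWB]
        _ = (Wᴴ * W) * diagonal (fun i => (sortedEigenvalues hB i : ℂ)) * (Wᴴ * W) := by
            simp only [Matrix.mul_assoc]
        _ = _ := by rw [hW, Matrix.one_mul, Matrix.mul_one])
  have htr : (Wᴴ * X * V * (Wᴴ * X * V)ᴴ).trace = (X * Xᴴ).trace := by
    calc _ = (Wᴴ * (X * (V * Vᴴ) * Xᴴ * W)).trace := by
          simp only [conjTranspose_mul, conjTranspose_conjTranspose, Matrix.mul_assoc]
      _ = _ := by rw [trace_mul_comm, hV', Matrix.mul_one, Matrix.mul_assoc, hW', Matrix.mul_one]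
  rwa [htr] at key

/-! ### Diagonal and rectangular diagonal matrices. -/

lemma diagonal_ofReal_conjTranspose {n : ℕ} (d : Fin n → ℝ) :
    (diagonal (fun i => (d i : ℂ)))ᴴ = diagonal (fun i => (d i : ℂ)) := by
  rw [diagonal_conjTranspose]
  congr 1
  ext i
  simp

lemma mul_diagonal_sqrt_mul_conjTranspose {n : ℕ} (U : Matrix (Fin n) (Fin n) ℂ) {d : Fin n → ℝ}
    (hd : ∀ i, 0 ≤ d i) :
    U * diagonal (fun i => ((√(d i) : ℝ) : ℂ)) * (U * diagonal (fun i => ((√(d i) : ℝ) : ℂ)))ᴴ =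
      U * diagonal (fun i => (d i : ℂ)) * Uᴴ := by
  have h : diagonal (fun i => ((√(d i) : ℝ) : ℂ)) * diagonal (fun i => ((√(d i) : ℝ) : ℂ)) =
      diagonal (fun i => (d i : ℂ)) := by
    rw [diagonal_mul_diagonal]
    congr 1
    ext i
    rw [← Complex.ofReal_mul, Real.mul_self_sqrt (hd i)]
  rw [conjTranspose_mul, diagonal_ofReal_conjTranspose, ← h]
  simp only [Matrix.mul_assoc]

lemma exists_eq_mul_conjTranspose {n : ℕ} {Q : Matrix (Fin n) (Fin n) ℂ} (hQ : Q.PosSemidef) :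
    ∃ Y : Matrix (Fin n) (Fin n) ℂ, Q = Y * Yᴴ := by
  obtain ⟨U, -, hU⟩ := exists_unitary_sortedEigenvalues hQ.isHermitian
  exact ⟨_, hU.trans (mul_diagonal_sqrt_mul_conjTranspose U (sortedEigenvalues_nonneg hQ)).symm⟩

lemma trace_unitary_conj_diagonal {n : ℕ} {U : Matrix (Fin n) (Fin n) ℂ}
    (hU : U ∈ unitaryGroup (Fin n) ℂ) (d : Fin n → ℝ) :
    (U * diagonal (fun i => (d i : ℂ)) * Uᴴ).trace.re = ∑ i, d i := by
  rw [mem_unitaryGroup_iff', star_eq_conjTranspose] at hU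
  rw [trace_mul_comm, ← Matrix.mul_assoc, hU, Matrix.one_mul, trace_diagonal]
  simp

lemma sortedEigenvalues_of_eq_diagonal {n : ℕ} {A : Matrix (Fin n) (Fin n) ℂ}
    (hA : A.IsHermitian) {d : Fin n → ℝ} (h : A = diagonal (fun i => (d i : ℂ)))
    (hd : Antitone d) : sortedEigenvalues hA = d :=
  sortedEigenvalues_eq_of_diagonalization hA (one_mem _) (by simpa using h) 1 hd

/-- The rectangular matrix with diagonal entries `f 0, f 1, …`. -/
def rectDiagonal (m n : ℕ) (f : ℕ → ℂ) : Matrix (Fin m) (Fin n) ℂ :=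
  of fun i k => if (i : ℕ) = k then f i else 0

lemma rectDiagonal_self (n : ℕ) (f : ℕ → ℂ) :
    rectDiagonal n n f = diagonal (fun i : Fin n => f i) := by
  ext i k
  simp [rectDiagonal, diagonal_apply, Fin.ext_iff]

/-- The inner dimension truncates the product at `n`; the hypothesis says that nothing is lost
there. -/
lemma rectDiagonal_mul (m : ℕ) {n : ℕ} (p : ℕ) {f g : ℕ → ℂ} (h : ∀ k, n ≤ k → f k * g k = 0) :
    rectDiagonal m n f * rectDiagonal n p g = rectDiagonal m p (fun k => f k * g k) := by
  ext i k
  simp only [rectDiagonal, mul_apply, of_apply]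
  by_cases hi : (i : ℕ) < n
  · rw [Finset.sum_eq_single (⟨i, hi⟩ : Fin n)]
    · simp
    · intro j _ hj
      rw [if_neg (fun hij => hj (Fin.ext hij.symm)), zero_mul]
    · simp
  · rw [Finset.sum_eq_zero fun j _ => by rw [if_neg (by omega), zero_mul], h i (by omega)]
    simp

lemma rectDiagonal_conjTranspose (m n : ℕ) (f : ℕ → ℝ) :
    (rectDiagonal m n (fun k => (f k : ℂ)))ᴴ = rectDiagonal n m (fun k => (f k : ℂ)) := by
  ext i k
  simp only [rectDiagonal, conjTranspose_apply, of_apply]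
  by_cases h : (i : ℕ) = k
  · simp [h]
  · rw [if_neg h, if_neg (Ne.symm h), star_zero]

/-! ### Construction of the aligned matrices. -/

lemma exists_source_covariance {m n : ℕ} (H : Matrix (Fin m) (Fin n) ℂ)
    (Q : Matrix (Fin n) (Fin n) ℂ) (hQ : Q.PosSemidef) :
    ∃ (Q' : Matrix (Fin n) (Fin n) ℂ) (hQ' : Q'.PosSemidef)
      (U : Matrix (Fin n) (Fin n) ℂ) (q : Fin n → ℝ) (ρ : Equiv.Perm (Fin (min m n))),
      U ∈ unitaryGroup (Fin n) ℂ ∧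
      Hᴴ * H = U * diagonal (fun i =>
        (sortedEigenvalues (isHermitian_conjTranspose_mul_self H) i : ℂ)) * Uᴴ ∧
      Q' = U * diagonal (fun i => (q i : ℂ)) * Uᴴ ∧
      (∀ i : Fin (min m n), q (Fin.castLE (min_le_right m n) i) =
        sortedEigenvalues hQ'.isHermitian (Fin.castLE (min_le_right m n) (ρ i))) ∧
      (∀ i : Fin m,
        sortedEigenvalues (isHermitian_mul_mul_conjTranspose H hQ.isHermitian) i =
        sortedEigenvalues (isHermitian_mul_mul_conjTranspose H hQ'.isHermitian) i) ∧
      (∀ i : Fin (min m n),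
        sortedEigenvalues (isHermitian_mul_mul_conjTranspose H hQ'.isHermitian)
          (Fin.castLE (min_le_left m n) i) =
        sortedEigenvalues hQ'.isHermitian (Fin.castLE (min_le_right m n) (ρ i)) *
        sortedEigenvalues (isHermitian_conjTranspose_mul_self H)
          (Fin.castLE (min_le_right m n) i)) ∧
      Q'.trace.re ≤ Q.trace.re := by
  have hG := posSemidef_conjTranspose_mul_self H
  have hμ := sortedEigenvalues_nonneg (hQ.mul_mul_conjTranspose_same H)
  set μ := sortedEigenvalues (isHermitian_mul_mul_conjTranspose H hQ.isHermitian) with hμdef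
  have hμa : Antitone μ := sortedEigenvalues_antitone _
  have hg := sortedEigenvalues_nonneg hG
  set g := sortedEigenvalues (isHermitian_conjTranspose_mul_self H) with hgdef
  obtain ⟨U, hU, hUG⟩ := exists_unitary_sortedEigenvalues (isHermitian_conjTranspose_mul_self H)
  obtain ⟨Y, hY⟩ := exists_eq_mul_conjTranspose hQ
  -- Moves the spectrum of `H Q Hᴴ` to `Yᴴ (Hᴴ H) Y`, the form to which the trace inequality
  -- applies.
  have hμν : zeroPad μ =
      zeroPad (sortedEigenvalues (isHermitian_conjTranspose_mul_self (H * Y))) := by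
    rw [← zeroPad_sortedEigenvalues_mul_comm (H * Y)]
    refine congrArg zeroPad (sortedEigenvalues_congr _ _ ?_)
    rw [hY, conjTranspose_mul]
    simp only [Matrix.mul_assoc]
  have hYG : Yᴴ * (Hᴴ * H) * Yᴴᴴ = (H * Y)ᴴ * (H * Y) := by
    rw [conjTranspose_mul, conjTranspose_conjTranspose]
    simp only [Matrix.mul_assoc]
  obtain ⟨hpos, hsum⟩ := pos_and_sum_sortedEigenvalues_div_le Yᴴ hG
    (isHermitian_mul_mul_conjTranspose Yᴴ hG.isHermitian)
  rw [sortedEigenvalues_congr _ (isHermitian_conjTranspose_mul_self (H * Y)) hYG,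
    ← hμν] at hpos hsum
  set q : ℕ → ℝ := fun i => zeroPad μ i / zeroPad g i with hq
  have hq0 : ∀ i, 0 ≤ q i := fun i => div_nonneg (zeroPad_nonneg hμ i) (zeroPad_nonneg hg i)
  -- Holds also where `g i = 0`, as then `μ i = 0`.
  have hqg : ∀ i, q i * zeroPad g i = zeroPad μ i := fun i => by
    rcases (zeroPad_nonneg hμ i).eq_or_lt with h0 | h0
    · simp [hq, ← h0]
    · exact div_mul_cancel₀ _ (hpos i h0).ne'
  have hqz : ∀ i, min m n ≤ i → q i = 0 := fun i hi => by
    rcases min_le_iff.mp hi with h | h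
    · simp [hq, zeroPad_of_le μ h]
    · simp [hq, zeroPad_of_le g h]
  set W := U * diagonal (fun i : Fin n => ((√(q i) : ℝ) : ℂ)) with hW
  have hWQ : W * Wᴴ = U * diagonal (fun i : Fin n => (q i : ℂ)) * Uᴴ :=
    mul_diagonal_sqrt_mul_conjTranspose U (fun i => hq0 i)
  have hQ' : (W * Wᴴ).PosSemidef := posSemidef_self_mul_conjTranspose W
  obtain ⟨ρ, hρ⟩ := exists_perm_sortedEigenvalues (min_le_right m n) hQ'.isHermitian hU hWQ
    (fun i => hq0 i) (fun i hi => hqz i hi)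
  have hU' := hU
  rw [mem_unitaryGroup_iff', star_eq_conjTranspose] at hU'
  -- In this order the product is already diagonal with decreasing entries; swapping the factors
  -- changes the spectrum only by zeros.
  have hdiag : (H * W)ᴴ * (H * W) = diagonal (fun i : Fin n => (zeroPad μ i : ℂ)) := by
    calc (H * W)ᴴ * (H * W) = Wᴴ * (Hᴴ * H) * W := by
          rw [conjTranspose_mul]
          simp only [Matrix.mul_assoc]
      _ = diagonal (fun i : Fin n => ((√(q i) : ℝ) : ℂ)) * (Uᴴ * U) * diagonal (fun i => (g i : ℂ))
            * (Uᴴ * U) * diagonal (fun i : Fin n => ((√(q i) : ℝ) : ℂ)) := by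
          rw [hUG, hW, conjTranspose_mul,
            diagonal_ofReal_conjTranspose (fun i : Fin n => √(q i))]
          simp only [Matrix.mul_assoc]
          rfl
      _ = _ := by
          rw [hU', Matrix.mul_one, Matrix.mul_one, diagonal_mul_diagonal, diagonal_mul_diagonal]
          congr 1
          ext i
          rw [← hqg, zeroPad_coe, ← Complex.ofReal_mul, ← Complex.ofReal_mul, mul_right_comm,
            Real.mul_self_sqrt (hq0 i)]
  have heig : sortedEigenvalues (isHermitian_mul_mul_conjTranspose H hQ'.isHermitian) = μ := by
    have h1 : zeroPad (sortedEigenvalues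
        (isHermitian_mul_mul_conjTranspose H hQ'.isHermitian)) = zeroPad μ := by
      rw [sortedEigenvalues_congr _ (isHermitian_mul_conjTranspose_self (H * W))
          (by rw [conjTranspose_mul H W]; simp only [Matrix.mul_assoc]),
        zeroPad_sortedEigenvalues_mul_comm, sortedEigenvalues_of_eq_diagonal _ hdiag
          (fun i j hij => zeroPad_antitone hμ hμa hij)]
      ext i
      by_cases hi : i < n
      · rw [zeroPad_of_lt _ hi]
      · rw [zeroPad_of_le _ (not_lt.mp hi), ← hqg, hqz i ((min_le_right _ _).trans (not_lt.mp hi)),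
          zero_mul]
    ext i
    rw [← zeroPad_coe μ i, ← h1, zeroPad_coe]
  refine ⟨W * Wᴴ, hQ', U, fun i => q i, ρ, hU, hUG, hWQ, hρ, fun i => by rw [heig],
    fun i => ?_, ?_⟩
  · rw [heig, ← hρ i, ← zeroPad_coe μ, ← zeroPad_coe g]
    exact (hqg i).symm
  · rw [hWQ, trace_unitary_conj_diagonal hU, Fin.sum_univ_eq_sum_range q n]
    rwa [conjTranspose_conjTranspose, trace_mul_comm, ← hY] at hsum

lemma exists_aligned_channel {m n : ℕ} (H : Matrix (Fin m) (Fin n) ℂ)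
    (Q : Matrix (Fin n) (Fin n) ℂ) (hQ : Q.PosSemidef) :
    ∃ (H' : Matrix (Fin m) (Fin n) ℂ)
      (U : Matrix (Fin n) (Fin n) ℂ) (s : Fin n → ℝ) (ρ : Equiv.Perm (Fin (min m n))),
      U ∈ unitaryGroup (Fin n) ℂ ∧
      Q = U * diagonal (fun i => (sortedEigenvalues hQ.isHermitian i : ℂ)) * Uᴴ ∧
      H'ᴴ * H' = U * diagonal (fun i => (s i : ℂ)) * Uᴴ ∧
      (∀ i : Fin (min m n), s (Fin.castLE (min_le_right m n) i) =
        sortedEigenvalues (isHermitian_mul_conjTranspose_self H')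
          (Fin.castLE (min_le_left m n) (ρ i))) ∧
      (∀ i : Fin m,
        sortedEigenvalues (isHermitian_mul_mul_conjTranspose H hQ.isHermitian) i =
        sortedEigenvalues (isHermitian_mul_mul_conjTranspose H' hQ.isHermitian) i) ∧
      (∀ i : Fin (min m n),
        sortedEigenvalues (isHermitian_mul_mul_conjTranspose H' hQ.isHermitian)
          (Fin.castLE (min_le_left m n) i) =
        sortedEigenvalues (isHermitian_mul_conjTranspose_self H')
          (Fin.castLE (min_le_left m n) (ρ i)) *
        sortedEigenvalues hQ.isHermitian (Fin.castLE (min_le_right m n) i)) ∧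
      (H' * H'ᴴ).trace.re ≤ (H * Hᴴ).trace.re := by
  have hμ := sortedEigenvalues_nonneg (hQ.mul_mul_conjTranspose_same H)
  obtain ⟨hpos, hsum⟩ := pos_and_sum_sortedEigenvalues_div_le H hQ
    (isHermitian_mul_mul_conjTranspose H hQ.isHermitian)
  set μ := sortedEigenvalues (isHermitian_mul_mul_conjTranspose H hQ.isHermitian) with hμdef
  have hμa : Antitone μ := sortedEigenvalues_antitone _
  have hg := sortedEigenvalues_nonneg hQ
  obtain ⟨U, hU, hUQ⟩ := exists_unitary_sortedEigenvalues hQ.isHermitian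
  set g := sortedEigenvalues hQ.isHermitian with hgdef
  set q : ℕ → ℝ := fun i => zeroPad μ i / zeroPad g i with hq
  have hq0 : ∀ i, 0 ≤ q i := fun i => div_nonneg (zeroPad_nonneg hμ i) (zeroPad_nonneg hg i)
  have hqg : ∀ i, q i * zeroPad g i = zeroPad μ i := fun i => by
    rcases (zeroPad_nonneg hμ i).eq_or_lt with h0 | h0
    · simp [hq, ← h0]
    · exact div_mul_cancel₀ _ (hpos i h0).ne'
  have hqm : ∀ i, m ≤ i → q i = 0 := fun i hi => by simp [hq, zeroPad_of_le μ hi]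
  have hqn : ∀ i, n ≤ i → q i = 0 := fun i hi => by simp [hq, zeroPad_of_le g hi]
  have hsq : ∀ k, ((√(q k) : ℝ) : ℂ) * ((√(q k) : ℝ) : ℂ) = (q k : ℂ) := fun k => by
    rw [← Complex.ofReal_mul, Real.mul_self_sqrt (hq0 k)]
  have hU' := hU
  rw [mem_unitaryGroup_iff', star_eq_conjTranspose] at hU'
  -- The new channel `D Uᴴ` has singular values `√(q k)` and right singular vectors from the
  -- eigenbasis of `Q`; its left ones are the standard basis.
  set D := rectDiagonal m n (fun k => ((√(q k) : ℝ) : ℂ)) with hD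
  have hDt : Dᴴ = rectDiagonal n m (fun k => ((√(q k) : ℝ) : ℂ)) :=
    rectDiagonal_conjTranspose m n (fun k => √(q k))
  have h1 : (D * Uᴴ)ᴴ * (D * Uᴴ) = U * diagonal (fun i : Fin n => (q i : ℂ)) * Uᴴ := by
    have : Dᴴ * D = diagonal (fun i : Fin n => (q i : ℂ)) := by
      rw [hDt, hD, rectDiagonal_mul n n (fun k hk => by rw [hsq, hqm k hk, Complex.ofReal_zero]),
        rectDiagonal_self]
      simp only [hsq]
    rw [← this, conjTranspose_mul, conjTranspose_conjTranspose]
    simp only [Matrix.mul_assoc]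
  have h2 : (D * Uᴴ) * (D * Uᴴ)ᴴ = diagonal (fun i : Fin m => (q i : ℂ)) := by
    rw [conjTranspose_mul, conjTranspose_conjTranspose, Matrix.mul_assoc, ← Matrix.mul_assoc Uᴴ,
      hU', Matrix.one_mul, hDt, hD,
      rectDiagonal_mul m m (fun k hk => by rw [hsq, hqn k hk, Complex.ofReal_zero]),
      rectDiagonal_self]
    simp only [hsq]
  have h3 : (D * Uᴴ) * Q * (D * Uᴴ)ᴴ = diagonal (fun i : Fin m => (μ i : ℂ)) := by
    calc (D * Uᴴ) * Q * (D * Uᴴ)ᴴ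
        = D * ((Uᴴ * U) * diagonal (fun i => (g i : ℂ)) * (Uᴴ * U)) * Dᴴ := by
          conv_lhs => rw [hUQ]
          rw [conjTranspose_mul, conjTranspose_conjTranspose]
          simp only [Matrix.mul_assoc]
      _ = D * rectDiagonal n n (fun k => (zeroPad g k : ℂ)) * Dᴴ := by
          rw [hU', Matrix.mul_one, Matrix.one_mul, rectDiagonal_self]
          simp only [zeroPad_coe]
      _ = diagonal (fun i : Fin m => (μ i : ℂ)) := by
          rw [hDt, hD, rectDiagonal_mul m n (fun k hk => by simp [hqn k hk]),
            rectDiagonal_mul m m (fun k hk => by simp [hqn k hk]), rectDiagonal_self]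
          congr 1
          ext i
          rw [mul_right_comm, hsq, ← Complex.ofReal_mul, hqg, zeroPad_coe]
  have heig : sortedEigenvalues
      (isHermitian_mul_mul_conjTranspose (D * Uᴴ) hQ.isHermitian) = μ :=
    sortedEigenvalues_of_eq_diagonal _ h3 hμa
  obtain ⟨ρ, hρ⟩ := exists_perm_sortedEigenvalues (min_le_left m n)
    (isHermitian_mul_conjTranspose_self (D * Uᴴ)) (one_mem _) (d := fun i : Fin m => q i)
    (by simpa using h2) (fun i => hq0 i) (fun i hi => by
      rcases min_le_iff.mp hi with h | h
      · exact hqm i h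
      · exact hqn i h)
  refine ⟨D * Uᴴ, U, fun i => q i, ρ, hU, hUQ, h1, hρ, fun i => by rw [heig], fun i => ?_, ?_⟩
  · rw [heig, ← hρ i, ← zeroPad_coe μ, ← zeroPad_coe g]
    exact (hqg i).symm
  · rw [h2, trace_diagonal, Complex.re_sum]
    simp only [Complex.ofReal_re]
    rwa [Fin.sum_univ_eq_sum_range q m]

theorem theorem1 (M Kr Kt : ℕ) :
    -- source-relay link
    (∀ (H₁ : Matrix (Fin Kr) (Fin M) ℂ) (Qs : Matrix (Fin M) (Fin M) ℂ) (hQs : Qs.PosSemidef),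
      ∃ (Qs' : Matrix (Fin M) (Fin M) ℂ) (hQs' : Qs'.PosSemidef)
        (U : Matrix (Fin M) (Fin M) ℂ) (q : Fin M → ℝ)
        (ρ : Equiv.Perm (Fin (min Kr M))),
        -- a common orthonormal eigenbasis (the columns of `U`) of `H₁ᴴ H₁` and `Qs'`
        U ∈ Matrix.unitaryGroup (Fin M) ℂ ∧
        H₁ᴴ * H₁ = U * Matrix.diagonal (fun i =>
          (sortedEigenvalues (Matrix.isHermitian_conjTranspose_mul_self H₁) i : ℂ)) * Uᴴ ∧
        Qs' = U * Matrix.diagonal (fun i => (q i : ℂ)) * Uᴴ ∧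
        (∀ i : Fin (min Kr M), q (Fin.castLE (min_le_right Kr M) i) =
          sortedEigenvalues hQs'.isHermitian (Fin.castLE (min_le_right Kr M) (ρ i))) ∧
        (∀ i : Fin Kr,
          sortedEigenvalues (Matrix.isHermitian_mul_mul_conjTranspose H₁ hQs.isHermitian) i =
          sortedEigenvalues (Matrix.isHermitian_mul_mul_conjTranspose H₁ hQs'.isHermitian) i) ∧
        (∀ i : Fin (min Kr M),
          sortedEigenvalues (Matrix.isHermitian_mul_mul_conjTranspose H₁ hQs'.isHermitian)
            (Fin.castLE (min_le_left Kr M) i) =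
          sortedEigenvalues hQs'.isHermitian (Fin.castLE (min_le_right Kr M) (ρ i)) *
          sortedEigenvalues (Matrix.isHermitian_conjTranspose_mul_self H₁)
            (Fin.castLE (min_le_right Kr M) i)) ∧
        Qs'.trace.re ≤ Qs.trace.re) ∧
    -- residual self-interference channel
    (∀ (Hr : Matrix (Fin Kr) (Fin Kt) ℂ) (Qr : Matrix (Fin Kt) (Fin Kt) ℂ) (hQr : Qr.PosSemidef),
      ∃ (Hr' : Matrix (Fin Kr) (Fin Kt) ℂ)
        (U : Matrix (Fin Kt) (Fin Kt) ℂ) (s : Fin Kt → ℝ)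
        (ρ : Equiv.Perm (Fin (min Kr Kt))),
        -- a common orthonormal eigenbasis (the columns of `U`) of `Qr` and `Hr'ᴴ Hr'`
        U ∈ Matrix.unitaryGroup (Fin Kt) ℂ ∧
        Qr = U * Matrix.diagonal (fun i =>
          (sortedEigenvalues hQr.isHermitian i : ℂ)) * Uᴴ ∧
        Hr'ᴴ * Hr' = U * Matrix.diagonal (fun i => (s i : ℂ)) * Uᴴ ∧
        (∀ i : Fin (min Kr Kt), s (Fin.castLE (min_le_right Kr Kt) i) =
          sortedEigenvalues (Matrix.isHermitian_mul_conjTranspose_self Hr')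
            (Fin.castLE (min_le_left Kr Kt) (ρ i))) ∧
        (∀ i : Fin Kr,
          sortedEigenvalues (Matrix.isHermitian_mul_mul_conjTranspose Hr hQr.isHermitian) i =
          sortedEigenvalues (Matrix.isHermitian_mul_mul_conjTranspose Hr' hQr.isHermitian) i) ∧
        (∀ i : Fin (min Kr Kt),
          sortedEigenvalues (Matrix.isHermitian_mul_mul_conjTranspose Hr' hQr.isHermitian)
            (Fin.castLE (min_le_left Kr Kt) i) =
          sortedEigenvalues (Matrix.isHermitian_mul_conjTranspose_self Hr')
            (Fin.castLE (min_le_left Kr Kt) (ρ i)) *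
          sortedEigenvalues hQr.isHermitian (Fin.castLE (min_le_right Kr Kt) i)) ∧
        (Hr' * Hr'ᴴ).trace.re ≤ (Hr * Hrᴴ).trace.re) := by
  exact ⟨exists_source_covariance, exists_aligned_channel⟩
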